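/- Let $c>0$ and $\alpha\ge 0$ be real numbers, and put $\omega_\alpha(y)=(1-y^2)^\alpha$ on $[-1,1]$. On the complex Hilbert space $L^2([-1,1],\omega_\alpha(x)\,dx)$ consider the weighted finite Fourier transform $$\mathcal F_c^{(\alpha)}f(x)=\int_{-1}^1 e^{icxy}f(y)\,\omega_\alpha(y)\,dy$$ and the self-adjoint operator $\mathcal Q_c^{(\alpha)}=\frac{c}{2\pi}\,(\mathcal F_c^{(\alpha)})^*\mathcal F_c^{(\alpha)}$. The space has an orthonormal basis $(\psi_n)_{n\ge 0}$ consisting of eigenfunctions of $\mathcal F_c^{(\alpha)}$, $\mathcal F_c^{(\alpha)}\psi_n=\mu_n\psi_n$, numbered so that $|\mu_0|\ge|\mu_1|\ge\cdots$. For every such numbering, the eigenvalues of $\mathcal Q_c^{(\alpha)}$, counted with multiplicity in nonincreasing order, are $\lambda_n=\frac{c}{2\pi}|\mu_n|^2$, $n\ge 0$, and for every integer $n>\frac{ec+1}{2}$ $$|\mu_n|\le \frac{k_\alpha}{c^{\frac{\alpha}{2}+1}\log\left(\frac{2n-1}{ec}\right)}\left(\frac{ec}{2n-1}\right)^{n+\frac{\alpha}{2}},\qquad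 k_\alpha=\left(\frac{2}{e}\right)^{1+\frac{\alpha}{2}}\pi\,\Gamma(\alpha+1)^{1/2},$$ and $$\lambda_n\le \frac{K_\alpha}{c^{\alpha+1}\log^2\left(\frac{2n-1}{ec}\right)}\left(\frac{ec}{2n-1}\right)^{2n+\alpha},\qquad K_\alpha=\frac{\pi}{2}\left(\frac{2}{e}\right)^{\alpha+2}\Gamma(\alpha+1).$$ -/

import Mathlib

open MeasureTheory

noncomputable section

/-- The measure `(1 - x²)^α dx` on the interval `[-1, 1]`. -/
def jacobiMeasure (α : ℝ) : Measure ℝ :=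
  (volume.restrict (Set.Icc (-1 : ℝ) 1)).withDensity
    (fun x => ENNReal.ofReal ((1 - x ^ 2) ^ α))

theorem isFiniteMeasure_jacobiMeasure {α : ℝ} (hα : 0 ≤ α) :
    IsFiniteMeasure (jacobiMeasure α) := by
  refine ⟨?_⟩
  rw [jacobiMeasure, withDensity_apply _ MeasurableSet.univ, Measure.restrict_univ]
  calc ∫⁻ x in Set.Icc (-1 : ℝ) 1, ENNReal.ofReal ((1 - x ^ 2) ^ α)
      ≤ ∫⁻ _x in Set.Icc (-1 : ℝ) 1, 1 := by
        refine setLIntegral_mono measurable_const fun x hx => ?_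
        rw [ENNReal.ofReal_le_one]
        refine Real.rpow_le_one ?_ ?_ hα
        · nlinarith [hx.1, hx.2]
        · nlinarith [sq_nonneg x]
    _ < ⊤ := by simp

/-- The function `x ↦ ∫ e^{icxy} f(y) dν(y)`. -/
def fourierIntegralFun (c : ℝ) (ν : Measure ℝ) (f : ℝ → ℂ) (x : ℝ) : ℂ :=
  ∫ y, Complex.exp (Complex.I * c * x * y) * f y ∂ν

theorem norm_fourierKernel (c x y : ℝ) : ‖Complex.exp (Complex.I * c * x * y)‖ = 1 := by
  have h : Complex.I * c * x * y = ((c * x * y : ℝ) : ℂ) * Complex.I := by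
    push_cast; ring
  rw [h, Complex.norm_exp_ofReal_mul_I]

theorem integrable_fourierKernel_mul (c : ℝ) {ν : Measure ℝ} {f : ℝ → ℂ}
    (hf : Integrable f ν) (x : ℝ) :
    Integrable (fun y : ℝ => Complex.exp (Complex.I * c * x * y) * f y) ν := by
  refine hf.norm.mono' ?_ (Filter.Eventually.of_forall fun y => ?_)
  · exact (Continuous.aestronglyMeasurable (by fun_prop)).mul hf.1
  · rw [norm_mul, norm_fourierKernel, one_mul]

theorem norm_fourierIntegralFun_le (c : ℝ) (ν : Measure ℝ) (f : ℝ → ℂ) (x : ℝ) :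
    ‖fourierIntegralFun c ν f x‖ ≤ ∫ y, ‖f y‖ ∂ν := by
  refine (norm_integral_le_integral_norm _).trans (le_of_eq ?_)
  simp_rw [norm_mul, norm_fourierKernel, one_mul]

theorem continuous_fourierIntegralFun (c : ℝ) {ν : Measure ℝ} {f : ℝ → ℂ}
    (hf : Integrable f ν) : Continuous (fourierIntegralFun c ν f) := by
  unfold fourierIntegralFun
  refine continuous_of_dominated (bound := fun y => ‖f y‖)
    (fun x => (integrable_fourierKernel_mul c hf x).1) (fun x => ?_) hf.norm ?_
  · exact Filter.Eventually.of_forall fun y => by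
      rw [norm_mul, norm_fourierKernel, one_mul]
  · exact Filter.Eventually.of_forall fun y => by fun_prop

theorem memLp_fourierIntegralFun (c : ℝ) {ν : Measure ℝ} [IsFiniteMeasure ν] {f : ℝ → ℂ}
    (hf : Integrable f ν) : MemLp (fourierIntegralFun c ν f) 2 ν :=
  MemLp.of_bound (continuous_fourierIntegralFun c hf).aestronglyMeasurable _
    (Filter.Eventually.of_forall (norm_fourierIntegralFun_le c ν f))

theorem integrable_of_L2 {ν : Measure ℝ} [IsFiniteMeasure ν] (f : Lp ℂ 2 ν) :
    Integrable f ν :=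
  (Lp.memLp f).integrable (by norm_num)

/-- The operator `f ↦ (x ↦ ∫ e^{icxy} f(y) dν(y))` on `L²(ν)`, as a linear map. -/
def fourierLinearMap (c : ℝ) (ν : Measure ℝ) [IsFiniteMeasure ν] : Lp ℂ 2 ν →ₗ[ℂ] Lp ℂ 2 ν where
  toFun f := (memLp_fourierIntegralFun c (integrable_of_L2 f)).toLp
  map_add' f g := by
    rw [← MemLp.toLp_add]
    refine MemLp.toLp_congr _ _ (Filter.Eventually.of_forall fun x => ?_)
    simp only [fourierIntegralFun, Pi.add_apply]
    rw [← integral_add (integrable_fourierKernel_mul c (integrable_of_L2 f) x)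
      (integrable_fourierKernel_mul c (integrable_of_L2 g) x)]
    refine integral_congr_ae ?_
    filter_upwards [Lp.coeFn_add f g] with y hy
    rw [hy, Pi.add_apply, mul_add]
  map_smul' a f := by
    rw [RingHom.id_apply, ← MemLp.toLp_const_smul]
    refine MemLp.toLp_congr _ _ (Filter.Eventually.of_forall fun x => ?_)
    simp only [fourierIntegralFun, Pi.smul_apply, smul_eq_mul]
    rw [← integral_const_mul]
    refine integral_congr_ae ?_
    filter_upwards [Lp.coeFn_smul a f] with y hy
    rw [hy, Pi.smul_apply, smul_eq_mul]
    ring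

theorem exists_bound_integral_norm (ν : Measure ℝ) [IsFiniteMeasure ν] :
    ∃ C : ℝ, 0 ≤ C ∧ ∀ f : Lp ℂ 2 ν, ∫ y, ‖f y‖ ∂ν ≤ C * ‖f‖ := by
  refine ⟨(ν Set.univ ^ (1 / (1 : ENNReal).toReal - 1 / (2 : ENNReal).toReal)).toReal,
    ENNReal.toReal_nonneg, fun f => ?_⟩
  have h1 := eLpNorm_le_eLpNorm_mul_rpow_measure_univ (p := 1) (q := 2) (μ := ν) (by norm_num)
    (Lp.aestronglyMeasurable f)
  have hfin : ν Set.univ ^ (1 / (1 : ENNReal).toReal - 1 / (2 : ENNReal).toReal) ≠ ⊤ :=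
    ENNReal.rpow_ne_top_of_nonneg (by norm_num) (measure_ne_top ν _)
  have h2 := ENNReal.toReal_mono (ENNReal.mul_ne_top (Lp.eLpNorm_ne_top f) hfin) h1
  rw [ENNReal.toReal_mul, ← Lp.norm_def] at h2
  rw [integral_norm_eq_lintegral_enorm (Lp.aestronglyMeasurable f), ← eLpNorm_one_eq_lintegral_enorm,
    mul_comm]
  exact h2

theorem exists_bound_fourierLinearMap (c : ℝ) (ν : Measure ℝ) [IsFiniteMeasure ν] :
    ∃ C : ℝ, ∀ f : Lp ℂ 2 ν, ‖fourierLinearMap c ν f‖ ≤ C * ‖f‖ := by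
  obtain ⟨C, hC, h⟩ := exists_bound_integral_norm ν
  refine ⟨(measureUnivNNReal ν : ℝ) ^ ((2 : ENNReal).toReal)⁻¹ * C, fun f => ?_⟩
  have hn : 0 ≤ C * ‖f‖ := mul_nonneg hC (norm_nonneg _)
  have hb := Lp.norm_le_of_ae_bound (f := fourierLinearMap c ν f) hn (by
    filter_upwards [(memLp_fourierIntegralFun c (integrable_of_L2 f)).coeFn_toLp] with x hx
    have : (fourierLinearMap c ν f : ℝ → ℂ) x = fourierIntegralFun c ν f x := hx
    rw [this]
    exact (norm_fourierIntegralFun_le c ν f x).trans (h f))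
  rw [mul_assoc]
  exact hb

/-- The weighted finite Fourier transform
`f ↦ (x ↦ ∫_{-1}^{1} e^{icxy} f(y) (1 - y²)^α dy)`,
as a bounded operator on `L²([-1,1], (1 - x²)^α dx)`. -/
def weightedFourier (c α : ℝ) (hα : 0 ≤ α) :
    Lp ℂ 2 (jacobiMeasure α) →L[ℂ] Lp ℂ 2 (jacobiMeasure α) :=
  haveI := isFiniteMeasure_jacobiMeasure hα
  (fourierLinearMap c (jacobiMeasure α)).mkContinuousOfExistsBound
    (exists_bound_fourierLinearMap c (jacobiMeasure α))

/-- The self-adjoint operator `(c / 2π) F* F`, with `F` the weighted finite Fourier transform. -/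
def weightedSinc (c α : ℝ) (hα : 0 ≤ α) :
    Lp ℂ 2 (jacobiMeasure α) →L[ℂ] Lp ℂ 2 (jacobiMeasure α) :=
  ((c / (2 * Real.pi) : ℝ) : ℂ) •
    (ContinuousLinearMap.adjoint (weightedFourier c α hα) ∘L weightedFourier c α hα)

/-- `μ 0, μ 1, …` are the eigenvalues of `T`, repeated according to multiplicity and arranged in
nonincreasing order of modulus: `μ n` is the eigenvalue of the `n`-th member of some
orthonormal (Hilbert) basis of eigenvectors of `T`. -/
def IsEigenvalueSequence {H : Type*} [NormedAddCommGroup H] [InnerProductSpace ℂ H]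
    (T : H →L[ℂ] H) (μ : ℕ → ℂ) : Prop :=
  Antitone (fun n => ‖μ n‖) ∧ ∃ ψ : HilbertBasis ℕ ℂ H, ∀ n, T (ψ n) = μ n • ψ n

end

/-! Write `F` for the transform and `ν` for the weighted measure. The adjoint of `F` has kernel
`e^{-icxy}`; as `ν` is even, `y ↦ -y` shows that `F` and its adjoint commute, so `F` is normal. It
is a norm limit of finite rank operators, hence compact, and it is injective: `F f = 0` forces every
moment of `f` to vanish. The spectral theorem gives an orthonormal eigenbasis; injectivity and
compactness allow its eigenvalues to be listed along `ℕ` by decreasing modulus. Normality also makes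
each eigenvector of `F` one of the adjoint, which yields the eigenvalues of the operator `Q`.

The decay rests on one half of the min-max principle (`IsEigenvalueSequence.norm_le`): `|μ n|` is at
most the norm of `F` on the complement of any subspace of dimension at most `n`. The subspace taken
is that of the polynomials of degree less than `n`. On its complement the kernel may be replaced by
its error under Chebyshev interpolation in `y`, of size `2 (|cx|/2)^n / n!`. The factor `|x|^n` is
kept, since its squared `L²` norm is a Beta integral of order `n^{-(α+1)}`. Stirling's bound and `q
log(1/q) ≤ 1`, with `q = ec/(2n-1)`, then bring the estimate into the stated form. -/

/-! ### Spectral theory of compact normal operators -/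

section Spectral

variable {H : Type*} [NormedAddCommGroup H] [InnerProductSpace ℂ H]

theorem Orthonormal.norm_sq_sum_smul {ι : Type*} {v : ι → H} (hv : Orthonormal ℂ v)
    (s : Finset ι) (l : ι → ℂ) : ‖∑ i ∈ s, l i • v i‖ ^ 2 = ∑ i ∈ s, ‖l i‖ ^ 2 := by
  have h := hv.inner_sum l l s
  rw [inner_self_eq_norm_sq_to_K] at h
  have h' : ((‖∑ i ∈ s, l i • v i‖ ^ 2 : ℝ) : ℂ) = ((∑ i ∈ s, ‖l i‖ ^ 2 : ℝ) : ℂ) := by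
    push_cast
    refine h.trans (Finset.sum_congr rfl fun i _ => ?_)
    rw [← Complex.conj_mul']
  exact_mod_cast h'

/-- Sort by decreasing `a`, ties broken by an injection into `ℕ`. Each index has finitely many
predecessors, so counting them embeds `ι` monotonically in `ℕ`, and an infinite subset of `ℕ` is
order isomorphic to `ℕ`. -/
theorem exists_equiv_nat_antitone {ι : Type*} [Infinite ι] {a : ι → ℝ} (h0 : ∀ i, 0 < a i)
    (hfin : ∀ ε > 0, {i | ε ≤ a i}.Finite) : ∃ e : ℕ ≃ ι, Antitone (a ∘ e) := by
  have hc : Countable ι := by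
    rw [← Set.countable_univ_iff]
    refine (Set.countable_iUnion fun n : ℕ =>
      (hfin (1 / ((n : ℝ) + 1)) (by positivity)).countable).mono fun i _ => ?_
    obtain ⟨n, hn⟩ := exists_nat_one_div_lt (h0 i)
    exact Set.mem_iUnion.2 ⟨n, hn.le⟩
  obtain ⟨enc, henc⟩ := hc.exists_injective_nat
  let key : ι → Lex (ℝᵒᵈ × ℕ) := fun i => toLex (OrderDual.toDual (a i), enc i)
  have hkey : Function.Injective key := fun i j hij =>
    henc (congrArg (fun p : Lex (ℝᵒᵈ × ℕ) => (ofLex p).2) hij)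
  have hle : ∀ {i j}, key i ≤ key j → a j ≤ a i := fun {i j} hij => by
    rcases Prod.Lex.le_iff.1 hij with h | h
    · exact (OrderDual.toDual_lt_toDual.1 h).le
    · exact (OrderDual.toDual_inj.1 h.1).ge
  have hlow : ∀ i, {j | key j < key i}.Finite := fun i =>
    (hfin _ (h0 i)).subset fun j hj => hle (le_of_lt hj)
  let rank : ι → ℕ := fun i => {j | key j < key i}.ncard
  have hmono : ∀ {i j}, key i < key j → rank i < rank j := fun {i j} hij =>
    Set.ncard_lt_ncard ⟨fun k hk => lt_trans hk hij, fun h => lt_irrefl (key i) (h hij)⟩ (hlow j)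
  have hinj : Function.Injective rank := fun i j hij => by
    rcases lt_trichotomy (key i) (key j) with h | h | h
    · exact absurd hij (hmono h).ne
    · exact hkey h
    · exact absurd hij (hmono h).ne'
  have : Infinite (Set.range rank) := (Set.infinite_range_of_injective hinj).to_subtype
  let f := Nat.Subtype.orderIsoOfNat (Set.range rank)
  let g := Equiv.ofInjective rank hinj
  refine ⟨f.toEquiv.trans g.symm, fun m n hmn => hle ?_⟩
  by_contra! hlt
  have h1 := hmono hlt
  have hg : ∀ k, rank ((f.toEquiv.trans g.symm) k) = (f k : ℕ) := fun k =>
    congrArg Subtype.val (g.apply_symm_apply (f k))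
  rw [hg, hg] at h1
  exact absurd (f.monotone hmn) (not_le.2 h1)

/-- The span of `ψ 0, …, ψ n` has dimension `n + 1`, more than `V`, so it contains a nonzero vector
orthogonal to `V`; by Pythagoras `T` stretches that vector by at least `|μ n|`. -/
theorem IsEigenvalueSequence.norm_le {T : H →L[ℂ] H} {μ : ℕ → ℂ} (h : IsEigenvalueSequence T μ)
    {V : Submodule ℂ H} [FiniteDimensional ℂ V] {n : ℕ} (hV : Module.finrank ℂ V ≤ n) {ε : ℝ}
    (hb : ∀ f ∈ Vᗮ, ‖T f‖ ≤ ε * ‖f‖) : ‖μ n‖ ≤ ε := by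
  obtain ⟨hanti, ψ, hψ⟩ := h
  let L : (Fin (n + 1) → ℂ) →ₗ[ℂ] V :=
    V.orthogonalProjectionOnto.toLinearMap ∘ₗ
      Fintype.linearCombination ℂ (fun i : Fin (n + 1) => ψ i)
  have hker := LinearMap.ker_ne_bot_of_finrank_lt (f := L) (by simp; omega)
  obtain ⟨l, hl, hl0⟩ := Submodule.exists_mem_ne_zero_of_ne_bot hker
  set f : H := ∑ i, l i • ψ (i : ℕ) with hf
  have hfV : f ∈ Vᗮ := by
    rw [← Submodule.orthogonalProjectionOnto_eq_zero_iff]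
    exact hl
  have hort : Orthonormal ℂ (fun i : Fin (n + 1) => ψ (i : ℕ)) :=
    ψ.orthonormal.comp _ Fin.val_injective
  have hTf : T f = ∑ i, (l i * μ i) • ψ (i : ℕ) := by
    simp [hf, hψ, smul_smul]
  have h1 : ‖f‖ ^ 2 = ∑ i, ‖l i‖ ^ 2 := hort.norm_sq_sum_smul _ _
  have h2 : ‖T f‖ ^ 2 = ∑ i, ‖l i * μ i‖ ^ 2 := by
    rw [hTf]; exact hort.norm_sq_sum_smul _ _
  have hfpos : 0 < ‖f‖ := by
    refine lt_of_le_of_ne (norm_nonneg _) fun h0 => ?_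
    refine absurd h1 (ne_of_lt ?_)
    rw [← h0, zero_pow two_ne_zero]
    obtain ⟨i, hi⟩ := Function.ne_iff.1 hl0
    exact Finset.sum_pos' (fun _ _ => by positivity)
      ⟨i, Finset.mem_univ _, pow_pos (norm_pos_iff.2 hi) 2⟩
  have h3 : ‖μ n‖ ^ 2 * ‖f‖ ^ 2 ≤ ‖T f‖ ^ 2 := by
    rw [h1, h2, Finset.mul_sum]
    refine Finset.sum_le_sum fun i _ => ?_
    rw [norm_mul, mul_pow, mul_comm]
    have := hanti (Nat.lt_succ_iff.1 i.2)
    dsimp only at this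
    gcongr
  have h4 : ‖μ n‖ * ‖f‖ ≤ ‖T f‖ :=
    le_of_sq_le_sq (by rw [mul_pow]; exact h3) (norm_nonneg _)
  exact le_of_mul_le_mul_right (h4.trans (hb f hfV)) hfpos

/-- Distinct images `T (v i) = a i • v i` with `|a i| ≥ ε` are orthogonal, hence at least `ε` apart,
so an infinite family of them has no convergent subsequence. -/
theorem IsCompactOperator.finite_le_norm_eigenvalue {T : H →L[ℂ] H} (hT : IsCompactOperator T)
    {ι : Type*} {v : ι → H} (hv : Orthonormal ℂ v) {a : ι → ℂ} (ha : ∀ i, T (v i) = a i • v i)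
    {ε : ℝ} (hε : 0 < ε) : {i | ε ≤ ‖a i‖}.Finite := by
  by_contra hinf
  let e : ℕ ↪ {i | ε ≤ ‖a i‖} := Set.Infinite.natEmbedding _ hinf
  have hK := hT.isCompact_closure_image_closedBall 1
  obtain ⟨z, -, φ, hφ, hz⟩ := hK.tendsto_subseq (x := fun n => T (v (e n).1)) fun n =>
    subset_closure ⟨v (e n).1, by simp [hv.1], rfl⟩
  obtain ⟨N, hN⟩ := Metric.cauchySeq_iff'.1 hz.cauchySeq ε hε
  have hlt := hN (N + 1) (by omega)
  set i : ι := (e (φ (N + 1))).1 with hi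
  set j : ι := (e (φ N)).1 with hj
  have hij : i ≠ j := fun h =>
    absurd (hφ.injective (e.injective (Subtype.ext h))) (by omega)
  have hlt' : ‖a i • v i - a j • v j‖ < ε := by
    rw [← ha, ← ha, ← dist_eq_norm]
    exact hlt
  have horth : inner ℂ (a i • v i) (a j • v j) = (0 : ℂ) := by
    rw [inner_smul_left, inner_smul_right, hv.2 hij]; simp
  have hsq : ‖a i • v i - a j • v j‖ ^ 2 = ‖a i • v i‖ ^ 2 + ‖a j • v j‖ ^ 2 := by
    rw [@norm_sub_sq ℂ, horth]; simp
  have hni : ε ≤ ‖a i • v i‖ := by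
    rw [norm_smul, hv.1, mul_one]; exact (e (φ (N + 1))).2
  nlinarith [norm_nonneg (a i • v i - a j • v j), norm_nonneg (a j • v j)]

variable [CompleteSpace H]

/-- For a normal operator the spectral radius equals the norm, so a nonzero `T` has a nonzero
spectral value; compactness makes it an eigenvalue. -/
theorem IsCompactOperator.exists_eigenvector_of_isStarNormal [Nontrivial H] {T : H →L[ℂ] H}
    (hT : IsCompactOperator T) (hn : IsStarNormal T) : ∃ (a : ℂ) (v : H), v ≠ 0 ∧ T v = a • v := by
  by_cases h0 : T = 0
  · obtain ⟨v, hv⟩ := exists_ne (0 : H)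
    exact ⟨0, v, hv, by simp [h0]⟩
  · obtain ⟨k, hk, hkr⟩ := spectrum.exists_nnnorm_eq_spectralRadius T
    rw [IsStarNormal.spectralRadius_eq_nnnorm T, ENNReal.coe_inj] at hkr
    have hk0 : k ≠ 0 := by
      rintro rfl
      exact h0 (nnnorm_eq_zero.1 (by simpa using hkr.symm))
    obtain ⟨v, hv⟩ := ((hT.hasEigenvalue_iff_mem_spectrum hk0).2 hk).exists_hasEigenvector
    exact ⟨k, v, hv.2, hv.apply_eq_smul⟩

/-- Invariance under the adjoint as well is what keeps the restriction normal: its adjoint is then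
the restriction of the adjoint. -/
theorem IsCompactOperator.exists_eigenvector_mem {T : H →L[ℂ] H} (hT : IsCompactOperator T)
    (hn : IsStarNormal T) {K : Submodule ℂ H} [CompleteSpace K] (hK : K ≠ ⊥)
    (h1 : ∀ v ∈ K, T v ∈ K) (h2 : ∀ v ∈ K, ContinuousLinearMap.adjoint T v ∈ K) :
    ∃ (a : ℂ) (v : H), v ∈ K ∧ v ≠ 0 ∧ T v = a • v := by
  have : Nontrivial K := Submodule.nontrivial_iff_ne_bot.2 hK
  let S : K →L[ℂ] K := T.restrict h1
  let S' : K →L[ℂ] K := (ContinuousLinearMap.adjoint T).restrict h2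
  have hS : IsCompactOperator S := hT.restrict' h1
  have hadj : S' = ContinuousLinearMap.adjoint S := by
    rw [ContinuousLinearMap.eq_adjoint_iff]
    intro x y
    exact ContinuousLinearMap.adjoint_inner_left T (y : H) (x : H)
  have hSn : IsStarNormal S := by
    constructor
    rw [ContinuousLinearMap.star_eq_adjoint, ← hadj]
    ext v
    exact congrArg (fun L : H →L[ℂ] H => L v) hn.star_comm_self.eq
  obtain ⟨a, v, hv, hav⟩ := hS.exists_eigenvector_of_isStarNormal hSn
  exact ⟨a, v, v.2, by simpa using hv, congrArg Subtype.val hav⟩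

/-- `T - a` is normal, so it and its adjoint have equal norms at `v`. -/
theorem adjoint_apply_eigenvector {T : H →L[ℂ] H} (hn : IsStarNormal T) {a : ℂ} {v : H}
    (h : T v = a • v) : ContinuousLinearMap.adjoint T v = (starRingEnd ℂ a) • v := by
  have hSn : IsStarNormal (T - algebraMap ℂ (H →L[ℂ] H) a) := by
    constructor
    rw [star_sub, ← algebraMap_star_comm]
    refine ((hn.star_comm_self).sub_right ?_).sub_left ?_
    · exact (Algebra.commutes a (star T)).symm
    · exact (Algebra.commutes _ _)
  have h1 := ContinuousLinearMap.isStarNormal_iff_norm_eq_adjoint.1 hSn v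
  have h2 : (T - algebraMap ℂ (H →L[ℂ] H) a) v = 0 := by
    simp [Algebra.algebraMap_eq_smul_one, h]
  rw [h2, norm_zero, ← ContinuousLinearMap.star_eq_adjoint, star_sub, ← algebraMap_star_comm,
    eq_comm, norm_eq_zero] at h1
  rw [← ContinuousLinearMap.star_eq_adjoint]
  simpa [Algebra.algebraMap_eq_smul_one, sub_eq_zero] using h1

/-- Zorn's lemma gives a maximal orthonormal set of eigenvectors. The complement of its span is
invariant under `T` and its adjoint, so if nonzero it would contain a further eigenvector. -/
theorem exists_orthonormal_eigenvectors {T : H →L[ℂ] H} (hT : IsCompactOperator T)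
    (hn : IsStarNormal T) : ∃ s : Set H, Orthonormal ℂ ((↑) : s → H) ∧
      (∀ v ∈ s, ∃ a : ℂ, T v = a • v) ∧ (Submodule.span ℂ s)ᗮ = ⊥ := by
  obtain ⟨s, hs⟩ := zorn_subset
    {s : Set H | Orthonormal ℂ ((↑) : s → H) ∧ ∀ v ∈ s, ∃ a : ℂ, T v = a • v} (by
      intro C hC hchain
      refine ⟨⋃₀ C, ⟨?_, ?_⟩, fun t ht => Set.subset_sUnion_of_mem ht⟩
      · exact orthonormal_sUnion_of_directed hchain.directedOn fun t ht => (hC ht).1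
      · rintro v ⟨t, ht, hv⟩
        exact (hC ht).2 v hv)
  refine ⟨s, hs.prop.1, hs.prop.2, ?_⟩
  by_contra hne
  obtain ⟨a, v, hv, hv0, hav⟩ := hT.exists_eigenvector_mem hn hne
    (fun v hv => by
      rw [Submodule.mem_orthogonal] at hv ⊢
      intro u hu
      rw [← ContinuousLinearMap.adjoint_inner_left]
      refine hv _ ?_
      induction hu using Submodule.span_induction with
      | mem x hx =>
        obtain ⟨b, hb⟩ := hs.prop.2 x hx
        rw [adjoint_apply_eigenvector hn hb]
        exact Submodule.smul_mem _ _ (Submodule.subset_span hx)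
      | zero => simp
      | add x y _ _ hx hy => rw [map_add]; exact Submodule.add_mem _ hx hy
      | smul c x _ hx => rw [map_smul]; exact Submodule.smul_mem _ _ hx)
    (fun v hv => by
      rw [Submodule.mem_orthogonal] at hv ⊢
      intro u hu
      rw [ContinuousLinearMap.adjoint_inner_right]
      refine hv _ ?_
      induction hu using Submodule.span_induction with
      | mem x hx =>
        obtain ⟨b, hb⟩ := hs.prop.2 x hx
        rw [hb]
        exact Submodule.smul_mem _ _ (Submodule.subset_span hx)
      | zero => simp
      | add x y _ _ hx hy => rw [map_add]; exact Submodule.add_mem _ hx hy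
      | smul c x _ hx => rw [map_smul]; exact Submodule.smul_mem _ _ hx)
  set w : H := ((‖v‖⁻¹ : ℝ) : ℂ) • v with hw
  have hw1 : ‖w‖ = 1 := by
    rw [hw, norm_smul]; simp [hv0]
  have hworth : ∀ u ∈ s, inner ℂ u w = 0 := fun u hu => by
    rw [hw, inner_smul_right, (Submodule.mem_orthogonal _ _).1 hv u (Submodule.subset_span hu),
      mul_zero]
  have hmem : insert w s ∈
      {s : Set H | Orthonormal ℂ ((↑) : s → H) ∧ ∀ v ∈ s, ∃ a : ℂ, T v = a • v} := by
    refine ⟨⟨?_, ?_⟩, ?_⟩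
    · rintro ⟨x, rfl | hx⟩
      · exact hw1
      · exact hs.prop.1.1 ⟨x, hx⟩
    · rintro ⟨x, rfl | hx⟩ ⟨y, rfl | hy⟩ hxy
      · exact absurd rfl hxy
      · exact inner_eq_zero_symm.1 (hworth y hy)
      · exact hworth x hx
      · exact hs.prop.1.2 (i := ⟨x, hx⟩) (j := ⟨y, hy⟩) fun h =>
          hxy (Subtype.ext (congrArg (fun z : s => (z : H)) h))
    · rintro x (rfl | hx)
      · exact ⟨a, by rw [hw, map_smul, hav, smul_comm]⟩
      · exact hs.prop.2 x hx
  -- By maximality the new unit vector already lies in `s`, so it is orthogonal to itself.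
  have hws : w ∈ s := hs.le_of_ge hmem (Set.subset_insert w s) (Set.mem_insert w s)
  have := hworth w hws
  rw [inner_self_eq_zero] at this
  simp [this] at hw1

theorem exists_isEigenvalueSequence {T : H →L[ℂ] H} (hT : IsCompactOperator T)
    (hn : IsStarNormal T) (hinj : ∀ v, T v = 0 → v = 0) (hdim : ¬ FiniteDimensional ℂ H) :
    ∃ μ : ℕ → ℂ, IsEigenvalueSequence T μ := by
  obtain ⟨s, hs, heig, hspan⟩ := exists_orthonormal_eigenvectors hT hn
  choose a ha using fun v : s => heig v v.2
  have hinf : Infinite s := by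
    by_contra hfin
    rw [not_infinite_iff_finite] at hfin
    have : FiniteDimensional ℂ (Submodule.span ℂ s) := FiniteDimensional.span_of_finite ℂ s.toFinite
    rw [Submodule.orthogonal_eq_bot_iff] at hspan
    rw [hspan] at this
    exact hdim (Module.finite_def.2 ((Submodule.fg_top _).1 (Module.finite_def.1 this)))
  -- Injectivity enters here: with zero eigenvalues present, a decreasing listing along `ℕ` could
  -- fail to exhaust the basis.
  have hpos : ∀ v : s, 0 < ‖a v‖ := fun v => by
    rw [norm_pos_iff]
    intro h0
    have := ha v
    rw [h0, zero_smul] at this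
    exact hs.ne_zero v (hinj _ this)
  obtain ⟨e, he⟩ := exists_equiv_nat_antitone hpos
    fun ε hε => hT.finite_le_norm_eigenvalue hs ha hε
  refine ⟨a ∘ e, he, HilbertBasis.mkOfOrthogonalEqBot (hs.comp e e.injective) ?_, fun n => ?_⟩
  · rw [Set.range_comp, e.range_eq_univ, Set.image_univ, Subtype.range_coe, hspan]
  · rw [HilbertBasis.coe_mkOfOrthogonalEqBot]
    exact ha (e n)

theorem IsEigenvalueSequence.smul_adjoint_comp {T : H →L[ℂ] H} (hn : IsStarNormal T) {μ : ℕ → ℂ}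
    (h : IsEigenvalueSequence T μ) {r : ℝ} (hr : 0 ≤ r) :
    IsEigenvalueSequence ((r : ℂ) • (ContinuousLinearMap.adjoint T ∘L T))
      (fun n => ((r * ‖μ n‖ ^ 2 : ℝ) : ℂ)) := by
  obtain ⟨hanti, ψ, hψ⟩ := h
  refine ⟨fun m n hmn => ?_, ψ, fun n => ?_⟩
  · simp only [Complex.norm_real, Real.norm_eq_abs]
    rw [abs_of_nonneg (by positivity), abs_of_nonneg (by positivity)]
    have := hanti hmn
    dsimp only at this
    gcongr
  · simp only [smul_apply, ContinuousLinearMap.comp_apply, hψ, map_smul,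
      adjoint_apply_eigenvector hn (hψ n), smul_smul]
    congr 1
    push_cast
    rw [Complex.mul_conj']

end Spectral

/-! ### Chebyshev interpolation of the exponential -/

section Interpolation

open Polynomial

/-- **Rolle's theorem**, iterated: if the first of a sequence of functions, each the derivative of
the preceding one, has `k + 1` zeros, then the `k`-th one has a zero. -/
theorem exists_eq_zero_of_strictMono_zeros (k : ℕ) : ∀ (G : ℕ → ℝ → ℝ)
    (_ : ∀ j s, HasDerivAt (G j) (G (j + 1) s) s) (z : Fin (k + 1) → ℝ) (_ : StrictMono z)
    (_ : ∀ i, G 0 (z i) = 0), ∃ s, G k s = 0 := by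
  induction k with
  | zero => exact fun G _ z _ h0 => ⟨z 0, h0 0⟩
  | succ k ih =>
    intro G hG z hz h0
    have hrolle : ∀ i : Fin (k + 1), ∃ w ∈ Set.Ioo (z i.castSucc) (z i.succ), G 1 w = 0 :=
      fun i => exists_hasDerivAt_eq_zero (hz i.castSucc_lt_succ)
        (fun s _ => (hG 0 s).continuousAt.continuousWithinAt) (by rw [h0, h0])
        (fun s _ => hG 0 s)
    choose w hw hw0 using hrolle
    refine ih (fun j => G (j + 1)) (fun j => hG (j + 1)) w ?_ hw0
    rw [Fin.strictMono_iff_lt_succ]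
    intro i
    exact (hw i.castSucc).2.trans_le ((hw i.succ).1.le.trans' (by rw [Fin.succ_castSucc]))

theorem exists_eq_zero_of_card_zeros {k : ℕ} {G : ℕ → ℝ → ℝ}
    (hG : ∀ j s, HasDerivAt (G j) (G (j + 1) s) s) {Z : Finset ℝ} (hZ : Z.card = k + 1)
    (h0 : ∀ z ∈ Z, G 0 z = 0) : ∃ s, G k s = 0 :=
  exists_eq_zero_of_strictMono_zeros k G hG (Z.orderEmbOfFin hZ) (Z.orderEmbOfFin hZ).strictMono
    fun i => h0 _ (Z.orderEmbOfFin_mem hZ i)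

theorem hasDerivAt_iterate_derivative_eval_ofReal (p : ℂ[X]) (j : ℕ) (s : ℝ) :
    HasDerivAt (fun s : ℝ => (derivative^[j] p).eval (s : ℂ))
      ((derivative^[j + 1] p).eval (s : ℂ)) s := by
  rw [Function.iterate_succ_apply']
  exact ((derivative^[j] p).hasDerivAt (s : ℂ)).comp_ofReal

theorem hasDerivAt_iterate_derivative_eval (p : ℝ[X]) (j : ℕ) (s : ℝ) :
    HasDerivAt (fun s : ℝ => (derivative^[j] p).eval s) ((derivative^[j + 1] p).eval s) s := by
  rw [Function.iterate_succ_apply']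
  exact (derivative^[j] p).hasDerivAt s

theorem hasDerivAt_pow_mul_cexp (t : ℝ) (j : ℕ) (s : ℝ) :
    HasDerivAt (fun s : ℝ => (Complex.I * t) ^ j * Complex.exp (Complex.I * t * s))
      ((Complex.I * t) ^ (j + 1) * Complex.exp (Complex.I * t * s)) s := by
  have h := (((hasDerivAt_id (s : ℂ)).const_mul (Complex.I * t)).cexp.const_mul
    ((Complex.I * t) ^ j)).comp_ofReal
  refine h.congr_deriv ?_
  simp only [id]
  ring

theorem norm_cexp_I_mul_mul (t s : ℝ) : ‖Complex.exp (Complex.I * t * s)‖ = 1 := by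
  simpa using norm_fourierKernel 1 t s

/-- Error of the Lagrange interpolation of `e^{its}` at real nodes. -/
theorem norm_cexp_sub_interpolate_le (t : ℝ) (Z : Finset ℝ) (y : ℝ) :
    ‖Complex.exp (Complex.I * t * y) -
      (Lagrange.interpolate Z ((↑) : ℝ → ℂ)
        fun s => Complex.exp (Complex.I * t * s)).eval (y : ℂ)‖ ≤
      |t| ^ Z.card / Z.card.factorial * |(∏ z ∈ Z, (X - C z)).eval y| := by
  set p : ℂ[X] := Lagrange.interpolate Z ((↑) : ℝ → ℂ) fun s => Complex.exp (Complex.I * t * s)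
    with hp
  set N : ℝ[X] := ∏ z ∈ Z, (X - C z) with hN
  set n := Z.card with hn
  have hinj : Set.InjOn ((↑) : ℝ → ℂ) Z := Complex.ofReal_injective.injOn
  have hpz : ∀ z ∈ Z, p.eval (z : ℂ) = Complex.exp (Complex.I * t * z) := fun z hz =>
    Lagrange.eval_interpolate_at_node _ hinj hz
  by_cases hyZ : y ∈ Z
  · rw [hpz y hyZ, sub_self, norm_zero]
    positivity
  have hNz : ∀ s, N.eval s = 0 ↔ s ∈ Z := fun s => by
    rw [hN, eval_prod, Finset.prod_eq_zero_iff]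
    simp only [eval_sub, eval_X, eval_C, sub_eq_zero]
    exact ⟨fun ⟨z, hz, h⟩ => h ▸ hz, fun h => ⟨s, h, rfl⟩⟩
  have hNy : N.eval y ≠ 0 := fun h => hyZ ((hNz y).1 h)
  have hNmonic : N.Monic := monic_prod_of_monic _ _ fun z _ => monic_X_sub_C z
  have hNdeg : N.natDegree = n := by
    rw [hN, natDegree_prod_of_monic _ _ fun z _ => monic_X_sub_C z]
    simp [hn]
  set E : ℂ := Complex.exp (Complex.I * t * y) - p.eval (y : ℂ) with hE
  -- Rolle's theorem needs real functions: rotating the error at `y` to be real and nonnegative lets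
  -- the real part carry all of it.
  obtain ⟨u, hu, huE⟩ : ∃ u : ℂ, ‖u‖ = 1 ∧ u * E = ‖E‖ := by
    by_cases hE0 : E = 0
    · exact ⟨1, by simp, by simp [hE0]⟩
    · have hE1 : (‖E‖ : ℂ) ≠ 0 := by simpa using hE0
      refine ⟨(starRingEnd ℂ) E / ‖E‖, by simp [hE0], ?_⟩
      rw [div_mul_eq_mul_div, Complex.conj_mul', sq, mul_div_assoc, div_self hE1, mul_one]
  -- `K` is chosen so that `G 0` below vanishes at `y` as well as at the `n` nodes. The `n`-th
  -- derivative `G n` then has a zero `s`, where `K * n!` equals the real part of a number of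
  -- modulus `|t|^n`.
  set K : ℝ := ‖E‖ / N.eval y with hK
  let G : ℕ → ℝ → ℝ := fun j s =>
    (u * ((Complex.I * t) ^ j * Complex.exp (Complex.I * t * s) -
      (derivative^[j] p).eval (s : ℂ))).re - K * (derivative^[j] N).eval s
  have hG : ∀ j s, HasDerivAt (G j) (G (j + 1) s) s := fun j s => by
    have h1 := ((hasDerivAt_pow_mul_cexp t j s).sub
      (hasDerivAt_iterate_derivative_eval_ofReal p j s)).const_mul u
    have h2 := Complex.reCLM.hasFDerivAt.comp_hasDerivAt s h1
    exact h2.sub ((hasDerivAt_iterate_derivative_eval N j s).const_mul K)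
  obtain ⟨s, hs⟩ := exists_eq_zero_of_card_zeros (k := n) hG (Z := insert y Z)
    (by rw [Finset.card_insert_of_notMem hyZ]) (by
      intro z hz
      rcases Finset.mem_insert.1 hz with rfl | hz
      · simp only [G, pow_zero, one_mul, Function.iterate_zero, id]
        rw [← hE, huE, hK, div_mul_cancel₀ _ hNy, Complex.ofReal_re, sub_self]
      · simp only [G, pow_zero, one_mul, Function.iterate_zero, id]
        rw [hpz z hz, (hNz z).2 hz]
        simp)
  have hpn : derivative^[n] p = 0 := by
    by_cases hp0 : p = 0
    · rw [hp0, iterate_derivative_zero]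
    · refine iterate_derivative_eq_zero ((natDegree_lt_iff_degree_lt hp0).2 ?_)
      exact Lagrange.degree_interpolate_lt _ hinj
  have hNn : (derivative^[n] N).eval s = n.factorial := by
    have h0 : (derivative^[n] N).natDegree = 0 := by
      have := natDegree_iterate_derivative N n
      omega
    rw [eq_C_of_natDegree_eq_zero h0, eval_C, coeff_iterate_derivative, zero_add,
      Nat.descFactorial_self, ← hNdeg, coeff_natDegree, hNmonic.leadingCoeff]
    simp
  simp only [G, hpn, hNn, eval_zero, sub_zero] at hs
  have hKn : |K| * n.factorial ≤ |t| ^ n := by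
    have h1 : K * n.factorial =
        (u * ((Complex.I * t) ^ n * Complex.exp (Complex.I * t * s))).re := by linarith
    have h2 := Complex.abs_re_le_norm (u * ((Complex.I * t) ^ n * Complex.exp (Complex.I * t * s)))
    rw [← h1, abs_mul, Nat.abs_cast] at h2
    refine h2.trans (le_of_eq ?_)
    rw [norm_mul, norm_mul, hu, norm_cexp_I_mul_mul]
    simp
  have hEK : ‖E‖ = |K| * |N.eval y| := by
    rw [← abs_mul, hK, div_mul_cancel₀ _ hNy, abs_norm]
  rw [hEK]
  gcongr
  rw [le_div_iff₀ (by positivity)]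
  exact hKn

/-- The nodes are the roots of `T_n`, which has leading coefficient `2^(n-1)` and is bounded by 1 on
the interval. -/
theorem exists_chebyshev_nodes {n : ℕ} (hn : n ≠ 0) : ∃ Z : Finset ℝ, Z.card = n ∧
    ∀ y ∈ Set.Icc (-1 : ℝ) 1, |(∏ z ∈ Z, (X - C z)).eval y| ≤ 2 / 2 ^ n := by
  obtain ⟨Z, hZ⟩ : ∃ Z : Finset ℝ, (Chebyshev.T ℝ n).roots = Z.val :=
    ⟨_, Chebyshev.roots_T_real n⟩
  have hcard : Z.card = n := by
    rw [Finset.card_def, ← hZ, Chebyshev.roots_T_real, ← Finset.card_def,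
      Finset.card_image_of_injOn ((Finset.range n).nodup_map_iff_injOn.mp
        (Chebyshev.roots_T_real_nodup n)), Finset.card_range]
  have hprod := C_leadingCoeff_mul_prod_multiset_X_sub_C (p := Chebyshev.T ℝ n) (by
    rw [hZ, ← Finset.card_def, hcard, Chebyshev.natDegree_T, Int.natAbs_natCast])
  rw [hZ, Chebyshev.leadingCoeff_T, Int.natAbs_natCast] at hprod
  refine ⟨Z, hcard, fun y hy => ?_⟩
  have h1 := Chebyshev.abs_eval_T_real_le_one n (abs_le.2 hy)
  have h2 : (∏ z ∈ Z, (X - C z)) = (Multiset.map (fun a => X - C a) Z.val).prod := rfl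
  rw [← hprod, ← h2, eval_mul, eval_C, abs_mul, abs_of_nonneg (by positivity)] at h1
  obtain ⟨m, rfl⟩ := Nat.exists_eq_succ_of_ne_zero hn
  rw [Nat.succ_sub_one] at h1
  rw [pow_succ, mul_comm ((2 : ℝ) ^ m), ← div_div, div_self two_ne_zero,
    le_div_iff₀ (by positivity), mul_comm]
  exact h1

/-- Chebyshev interpolation approximates `e^{its}` on `[-1, 1]` by a polynomial of degree less
than `n` with error at most `2 (|t| / 2)^n / n!`. -/
theorem exists_polynomial_norm_cexp_sub_le (t : ℝ) {n : ℕ} (hn : n ≠ 0) :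
    ∃ p : ℂ[X], p.degree < n ∧ ∀ y ∈ Set.Icc (-1 : ℝ) 1,
      ‖Complex.exp (Complex.I * t * y) - p.eval (y : ℂ)‖ ≤ 2 * (|t| / 2) ^ n / n.factorial := by
  obtain ⟨Z, hZ, hb⟩ := exists_chebyshev_nodes hn
  refine ⟨_, hZ ▸ Lagrange.degree_interpolate_lt (fun s : ℝ => Complex.exp (Complex.I * t * s))
    Complex.ofReal_injective.injOn, fun y hy => (norm_cexp_sub_interpolate_le t Z y).trans ?_⟩
  rw [hZ]
  calc |t| ^ n / n.factorial * |(∏ z ∈ Z, (X - C z)).eval y|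
      ≤ |t| ^ n / n.factorial * (2 / 2 ^ n) := by gcongr; exact hb y hy
    _ = 2 * (|t| / 2) ^ n / n.factorial := by rw [div_pow]; ring

end Interpolation

/-! ### Gamma function bounds and the even moments of the weight -/

section Gamma

/-- By convexity of `log Γ`, its slope from `x` to `x + 1`, which is `log x`, is at most its slope
from `x` to `x + s`. -/
theorem Real.Gamma_mul_rpow_le {x s : ℝ} (hx : 0 < x) (hs : 1 ≤ s) :
    Real.Gamma x * x ^ s ≤ Real.Gamma (x + s) := by
  have hxs : 0 < x + s := by linarith
  have h := Real.convexOn_log_Gamma.secant_mono (a := x) (x := x + 1) (y := x + s) hx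
    (by simp only [Set.mem_Ioi]; linarith) hxs (by linarith) (by linarith) (by linarith)
  simp only [Function.comp_apply, add_sub_cancel_left, div_one] at h
  rw [Real.Gamma_add_one hx.ne', Real.log_mul hx.ne' (Real.Gamma_pos_of_pos hx).ne',
    add_sub_cancel_right, le_div_iff₀ (by linarith)] at h
  rw [← Real.log_le_log_iff (mul_pos (Real.Gamma_pos_of_pos hx) (Real.rpow_pos_of_pos hx s))
    (Real.Gamma_pos_of_pos hxs), Real.log_mul (Real.Gamma_pos_of_pos hx).ne'
    (Real.rpow_pos_of_pos hx s).ne', Real.log_rpow hx]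
  linarith

theorem Real.integral_rpow_mul_one_sub_rpow {u v : ℝ} (hu : 0 < u) (hv : 0 < v) :
    ∫ x in (0 : ℝ)..1, x ^ (u - 1) * (1 - x) ^ (v - 1) =
      Real.Gamma u * Real.Gamma v / Real.Gamma (u + v) := by
  have h := ProbabilityTheory.beta_eq_betaIntegralReal u v hu hv
  rw [ProbabilityTheory.beta, Complex.betaIntegral] at h
  rw [h, ← Complex.ofReal_re (∫ x in (0 : ℝ)..1, x ^ (u - 1) * (1 - x) ^ (v - 1)),
    ← intervalIntegral.integral_ofReal]
  congr 1
  refine intervalIntegral.integral_congr fun x hx => ?_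
  rw [Set.uIcc_of_le zero_le_one] at hx
  push_cast
  rw [Complex.ofReal_cpow hx.1, Complex.ofReal_cpow (by linarith [hx.2])]
  push_cast
  rfl

/-- By evenness and the substitution `x = y²` this is the Beta integral with parameters `n + 1/2`
and `α + 1`. -/
theorem integral_pow_mul_one_sub_sq_rpow_eq {α : ℝ} (hα : 0 ≤ α) {n : ℕ} (hn : n ≠ 0) :
    ∫ y in (-1 : ℝ)..1, y ^ (2 * n) * (1 - y ^ 2) ^ α =
      Real.Gamma (n + 1 / 2) * Real.Gamma (α + 1) / Real.Gamma (n + 1 / 2 + (α + 1)) := by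
  have hn1 : (1 : ℝ) ≤ n := by exact_mod_cast Nat.one_le_iff_ne_zero.2 hn
  have hcont : Continuous fun y : ℝ => y ^ (2 * n) * (1 - y ^ 2) ^ α :=
    (continuous_pow _).mul ((continuous_const.sub (continuous_pow 2)).rpow_const
      fun _ => Or.inr hα)
  have heven : ∫ y in (-1 : ℝ)..0, y ^ (2 * n) * (1 - y ^ 2) ^ α =
      ∫ y in (0 : ℝ)..1, y ^ (2 * n) * (1 - y ^ 2) ^ α := by
    have h := intervalIntegral.integral_comp_neg (a := 0) (b := 1)
      (fun y : ℝ => y ^ (2 * n) * (1 - y ^ 2) ^ α)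
    rw [neg_zero] at h
    rw [← h]
    simp [pow_mul]
  rw [← Real.integral_rpow_mul_one_sub_rpow (by positivity) (by positivity),
    ← intervalIntegral.integral_add_adjacent_intervals (hcont.intervalIntegrable _ _)
      (hcont.intervalIntegrable 0 1), heven, ← two_mul,
    ← intervalIntegral.integral_const_mul]
  have hg : Continuous fun x : ℝ => x ^ ((n : ℝ) + 1 / 2 - 1) * (1 - x) ^ (α + 1 - 1) :=
    (continuous_id.rpow_const fun _ => Or.inr (by linarith)).mul
      ((continuous_const.sub continuous_id).rpow_const fun _ => Or.inr (by linarith))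
  have h := intervalIntegral.integral_comp_mul_deriv (a := 0) (b := 1)
    (f := fun y : ℝ => y ^ 2) (f' := fun y => 2 * y)
    (g := fun x : ℝ => x ^ ((n : ℝ) + 1 / 2 - 1) * (1 - x) ^ (α + 1 - 1))
    (fun y _ => by simpa using hasDerivAt_pow 2 y) (by fun_prop) hg
  rw [zero_pow two_ne_zero, one_pow] at h
  rw [← h]
  refine intervalIntegral.integral_congr fun y hy => ?_
  rw [Set.uIcc_of_le zero_le_one] at hy
  have hy2 : (y ^ 2) ^ ((n : ℝ) + 1 / 2 - 1) * y = y ^ (2 * n) := by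
    rcases hy.1.eq_or_lt with rfl | hy0
    · simp [hn]
    · rw [← Real.rpow_natCast y 2, ← Real.rpow_mul hy.1, ← Real.rpow_add_one hy0.ne',
        ← Real.rpow_natCast]
      congr 1
      push_cast
      ring
  simp only [Function.comp_apply, add_sub_cancel_right]
  rw [← hy2]
  ring

theorem integral_pow_mul_one_sub_sq_rpow_le {α : ℝ} (hα : 0 ≤ α) {n : ℕ} (hn : n ≠ 0) :
    ∫ y in (-1 : ℝ)..1, y ^ (2 * n) * (1 - y ^ 2) ^ α ≤
      Real.Gamma (α + 1) / (n : ℝ) ^ (α + 1) := by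
  have hn0 : (0 : ℝ) < n := by positivity
  have hG : 0 < Real.Gamma (n + 1 / 2 : ℝ) := Real.Gamma_pos_of_pos (by positivity)
  have hG' : 0 < Real.Gamma (α + 1) := Real.Gamma_pos_of_pos (by positivity)
  have h := Real.Gamma_mul_rpow_le (x := n + 1 / 2) (s := α + 1) (by positivity) (by linarith)
  rw [integral_pow_mul_one_sub_sq_rpow_eq hα hn, div_le_div_iff₀ (by
    exact Real.Gamma_pos_of_pos (by positivity)) (by positivity)]
  have h2 : (n : ℝ) ^ (α + 1) ≤ (n + 1 / 2 : ℝ) ^ (α + 1) :=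
    Real.rpow_le_rpow hn0.le (by linarith) (by linarith)
  calc _ = Real.Gamma (α + 1) * (Real.Gamma (n + 1 / 2) * (n : ℝ) ^ (α + 1)) := by ring
    _ ≤ Real.Gamma (α + 1) * (Real.Gamma (n + 1 / 2) * (n + 1 / 2 : ℝ) ^ (α + 1)) := by gcongr
    _ ≤ _ := by gcongr

end Gamma

/-! ### Compactness from smallness on complements -/

section Compactness

variable {H : Type*} [NormedAddCommGroup H] [InnerProductSpace ℂ H] [CompleteSpace H]

/-- With `P` the projection onto `V`, the operator `T P` has finite rank and `T - T P` is `T` after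
the projection onto the complement. Compact operators are closed in norm. -/
theorem isCompactOperator_of_norm_le_on_orthogonal {T : H →L[ℂ] H}
    (h : ∀ ε > 0, ∃ V : Submodule ℂ H, FiniteDimensional ℂ V ∧
      ∀ f ∈ Vᗮ, ‖T f‖ ≤ ε * ‖f‖) : IsCompactOperator T := by
  refine isClosed_setOfPred_isCompactOperator.closure_subset (Metric.mem_closure_iff.2 ?_)
  intro ε hε
  obtain ⟨V, hV, hb⟩ := h (ε / 2) (by positivity)
  have : ProperSpace V := FiniteDimensional.proper_rclike ℂ V
  refine ⟨(T ∘L V.subtypeL) ∘L V.orthogonalProjectionOnto,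
    (isCompactOperator_id (E := V)).comp_clm V.orthogonalProjectionOnto |>.clm_comp
      (T ∘L V.subtypeL), ?_⟩
  rw [dist_eq_norm]
  refine lt_of_le_of_lt (ContinuousLinearMap.opNorm_le_bound _ (by positivity) fun f => ?_)
    (half_lt_self hε)
  have h1 : (T - (T ∘L V.subtypeL) ∘L V.orthogonalProjectionOnto) f = T (Vᗮ.starProjection f) := by
    rw [Submodule.starProjection_orthogonal']
    simp
  rw [h1]
  refine (hb _ (Submodule.starProjection_apply_mem _ _)).trans ?_
  gcongr
  exact Submodule.norm_starProjection_apply_le _ _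

end Compactness

/-! ### Norms in `L²` -/

section L2

variable {ν : Measure ℝ}

theorem L2_norm_sq_eq_integral (f : Lp ℂ 2 ν) : ‖f‖ ^ 2 = ∫ y, ‖f y‖ ^ 2 ∂ν := by
  have h := inner_self_eq_norm_sq_to_K (𝕜 := ℂ) f
  rw [L2.inner_def] at h
  have h2 : ((∫ y, ‖f y‖ ^ 2 ∂ν : ℝ) : ℂ) = ((‖f‖ ^ 2 : ℝ) : ℂ) := by
    rw [← integral_complex_ofReal, Complex.ofReal_pow]
    refine Eq.trans (integral_congr_ae (Filter.Eventually.of_forall fun y => ?_)) h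
    simp [inner_self_eq_norm_sq_to_K]
  exact_mod_cast h2.symm

theorem integral_norm_le_sqrt_mul_norm [IsFiniteMeasure ν] (f : Lp ℂ 2 ν) :
    ∫ y, ‖f y‖ ∂ν ≤ √(ν.real Set.univ) * ‖f‖ := by
  have h1 := eLpNorm_le_eLpNorm_mul_rpow_measure_univ (p := 1) (q := 2) (μ := ν) (by norm_num)
    (Lp.aestronglyMeasurable f)
  have hfin : ν Set.univ ^ (1 / (1 : ENNReal).toReal - 1 / (2 : ENNReal).toReal) ≠ ⊤ :=
    ENNReal.rpow_ne_top_of_nonneg (by norm_num) (measure_ne_top ν _)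
  have h2 := ENNReal.toReal_mono (ENNReal.mul_ne_top (Lp.eLpNorm_ne_top f) hfin) h1
  rw [ENNReal.toReal_mul, ← Lp.norm_def, ← ENNReal.toReal_rpow] at h2
  rw [integral_norm_eq_lintegral_enorm (Lp.aestronglyMeasurable f), ← eLpNorm_one_eq_lintegral_enorm,
    mul_comm, Real.sqrt_eq_rpow]
  refine h2.trans (le_of_eq ?_)
  rw [Measure.real]
  norm_num

end L2

/-! ### Polynomials in `L²(ν)` -/

section PolynomialLp

open Polynomial

variable {ν : Measure ℝ}

theorem memLp_polynomial_eval [IsFiniteMeasure ν] (hν : ∀ᵐ y ∂ν, y ∈ Set.Icc (-1 : ℝ) 1)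
    (p : ℂ[X]) : MemLp (fun y : ℝ => p.eval (y : ℂ)) 2 ν := by
  have hc : Continuous fun y : ℝ => p.eval (y : ℂ) := p.continuous.comp Complex.continuous_ofReal
  obtain ⟨C, hC⟩ := isCompact_Icc.exists_bound_of_continuousOn
    (hc.continuousOn (s := Set.Icc (-1 : ℝ) 1))
  exact MemLp.of_bound hc.aestronglyMeasurable C (hν.mono fun y hy => hC y hy)

/-- Restriction of polynomials to a measure on `[-1, 1]`, as elements of `L²`. -/
noncomputable def polynomialLp (ν : Measure ℝ) [IsFiniteMeasure ν]
    (hν : ∀ᵐ y ∂ν, y ∈ Set.Icc (-1 : ℝ) 1) : ℂ[X] →ₗ[ℂ] Lp ℂ 2 ν where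
  toFun p := (memLp_polynomial_eval hν p).toLp
  map_add' p q := by
    rw [← MemLp.toLp_add]
    exact MemLp.toLp_congr _ _ (Filter.Eventually.of_forall fun x => by simp)
  map_smul' a p := by
    rw [RingHom.id_apply, ← MemLp.toLp_const_smul]
    exact MemLp.toLp_congr _ _ (Filter.Eventually.of_forall fun x => by simp)

/-- Conjugating the coefficients cancels the conjugation in the first slot of the inner product,
because `y` is real. -/
theorem inner_polynomialLp [IsFiniteMeasure ν] (hν : ∀ᵐ y ∂ν, y ∈ Set.Icc (-1 : ℝ) 1)
    (p : ℂ[X]) (f : Lp ℂ 2 ν) :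
    inner ℂ (polynomialLp ν hν (p.map (starRingEnd ℂ))) f = ∫ y : ℝ, p.eval (y : ℂ) * f y ∂ν := by
  rw [L2.inner_def]
  refine integral_congr_ae ?_
  filter_upwards [(memLp_polynomial_eval hν (p.map (starRingEnd ℂ))).coeFn_toLp] with y hy
  have h : (polynomialLp ν hν (p.map (starRingEnd ℂ)) : ℝ → ℂ) y =
    (p.map (starRingEnd ℂ)).eval (y : ℂ) := hy
  have h2 : (p.map (starRingEnd ℂ)).eval (y : ℂ) = (starRingEnd ℂ) (p.eval (y : ℂ)) := by
    rw [← eval₂_hom, eval_map, Complex.conj_ofReal]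
  rw [h, RCLike.inner_apply, h2, Complex.conj_conj, mul_comm]

theorem integrable_polynomial_mul [IsFiniteMeasure ν] (hν : ∀ᵐ y ∂ν, y ∈ Set.Icc (-1 : ℝ) 1)
    (p : ℂ[X]) {f : ℝ → ℂ} (hf : Integrable f ν) :
    Integrable (fun y : ℝ => p.eval (y : ℂ) * f y) ν := by
  have hc : Continuous fun y : ℝ => p.eval (y : ℂ) := p.continuous.comp Complex.continuous_ofReal
  obtain ⟨C, hC⟩ := isCompact_Icc.exists_bound_of_continuousOn
    (hc.continuousOn (s := Set.Icc (-1 : ℝ) 1))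
  exact hf.bdd_mul hc.aestronglyMeasurable (hν.mono fun y hy => hC y hy)

/-- Weierstrass approximation passes from polynomials to smooth test functions of compact support,
and these determine `f`. -/
theorem ae_eq_zero_of_integral_polynomial_mul_eq_zero [IsFiniteMeasure ν]
    (hν : ∀ᵐ y ∂ν, y ∈ Set.Icc (-1 : ℝ) 1) {f : ℝ → ℂ} (hf : Integrable f ν)
    (h : ∀ p : ℂ[X], ∫ y : ℝ, p.eval (y : ℂ) * f y ∂ν = 0) : ∀ᵐ y ∂ν, f y = 0 := by
  refine ae_eq_zero_of_integral_contDiff_smul_eq_zero hf.locallyIntegrable fun g hg hgs => ?_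
  by_contra hne
  have hgint : Integrable (fun y => g y • f y) ν := by
    obtain ⟨C, hC⟩ := hg.continuous.bounded_above_of_compact_support hgs
    exact hf.bdd_smul _ hg.continuous.aestronglyMeasurable (Filter.Eventually.of_forall hC)
  have hpos : 0 < ‖∫ y, g y • f y ∂ν‖ := norm_pos_iff.2 hne
  set I := ∫ y, ‖f y‖ ∂ν with hI
  have hI0 : 0 ≤ I := integral_nonneg fun _ => norm_nonneg _
  -- This tolerance would bound the integral by less than half of itself; `I + 1` covers the case `I
  -- = 0`.
  obtain ⟨q, hq⟩ := exists_polynomial_near_of_continuousOn (-1) 1 g hg.continuous.continuousOn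
    (‖∫ y, g y • f y ∂ν‖ / (2 * (I + 1))) (by positivity)
  have hqe : ∀ y : ℝ, (q.map (algebraMap ℝ ℂ)).eval (y : ℂ) = ((q.eval y : ℝ) : ℂ) := fun y => by
    rw [eval_map]
    exact eval₂_at_apply (algebraMap ℝ ℂ) y
  have hqint := integrable_polynomial_mul hν (q.map (algebraMap ℝ ℂ)) hf
  have hdiff : ∫ y, g y • f y ∂ν =
      ∫ y : ℝ, (g y • f y - (q.map (algebraMap ℝ ℂ)).eval (y : ℂ) * f y) ∂ν := by
    rw [integral_sub hgint hqint, h, sub_zero]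
  have hle : ‖∫ y, g y • f y ∂ν‖ ≤ ‖∫ y, g y • f y ∂ν‖ / (2 * (I + 1)) * I := by
    conv_lhs => rw [hdiff]
    rw [hI, ← integral_const_mul]
    refine norm_integral_le_of_norm_le (hf.norm.const_mul _) (hν.mono fun y hy => ?_)
    rw [hqe, Complex.real_smul, ← sub_mul, norm_mul, ← Complex.ofReal_sub, Complex.norm_real,
      Real.norm_eq_abs, abs_sub_comm]
    gcongr
    exact (hq y hy).le
  rw [div_mul_eq_mul_div, le_div_iff₀ (by positivity)] at hle
  nlinarith

/-- A polynomial that vanishes almost everywhere vanishes on the whole open interval by continuity,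
so it has infinitely many roots. -/
theorem polynomialLp_injective [IsFiniteMeasure ν] (hν : ∀ᵐ y ∂ν, y ∈ Set.Icc (-1 : ℝ) 1)
    (hac : volume.restrict (Set.Ioo (-1 : ℝ) 1) ≪ ν) : Function.Injective (polynomialLp ν hν) := by
  rw [injective_iff_map_eq_zero]
  intro p hp
  have h1 : (fun y : ℝ => p.eval (y : ℂ)) =ᵐ[ν] fun _ => 0 := by
    filter_upwards [(memLp_polynomial_eval hν p).coeFn_toLp, Lp.coeFn_zero ℂ 2 ν] with y h1 h2
    have h3 : (polynomialLp ν hν p : ℝ → ℂ) y = p.eval (y : ℂ) := h1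
    rw [← h3, hp, h2]
    rfl
  have h2 := Measure.eqOn_open_of_ae_eq (hac.ae_eq h1) isOpen_Ioo
    (p.continuous.comp Complex.continuous_ofReal).continuousOn continuousOn_const
  refine p.eq_zero_of_infinite_isRoot (((Set.Ioo_infinite (by norm_num : (-1 : ℝ) < 1)).image
    Complex.ofReal_injective.injOn).mono ?_)
  rintro _ ⟨y, hy, rfl⟩
  exact h2 hy

theorem not_finiteDimensional_L2 [IsFiniteMeasure ν] (hν : ∀ᵐ y ∂ν, y ∈ Set.Icc (-1 : ℝ) 1)
    (hac : volume.restrict (Set.Ioo (-1 : ℝ) 1) ≪ ν) : ¬ FiniteDimensional ℂ (Lp ℂ 2 ν) := by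
  intro h
  exact Polynomial.not_finite
    (Module.Finite.of_injective (polynomialLp ν hν) (polynomialLp_injective hν hac))

end PolynomialLp

/-! ### The Fourier operator on a measure carried by `[-1, 1]` -/

section FourierOperator

open Polynomial

variable {ν : Measure ℝ}

theorem hasDerivAt_fourierIntegralFun (hν : ∀ᵐ y ∂ν, y ∈ Set.Icc (-1 : ℝ) 1) (c : ℝ) {f : ℝ → ℂ}
    (hf : Integrable f ν) (x : ℝ) : HasDerivAt (fourierIntegralFun c ν f)
      (Complex.I * c * fourierIntegralFun c ν (fun y => y * f y) x) x := by
  have h := (hasDerivAt_integral_of_dominated_loc_of_deriv_le (μ := ν) (s := Set.univ) (x₀ := x)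
    (F := fun x y : ℝ => Complex.exp (Complex.I * c * x * y) * f y)
    (F' := fun x y : ℝ => Complex.I * c * (Complex.exp (Complex.I * c * x * y) * (y * f y)))
    (bound := fun y => |c| * ‖f y‖) Filter.univ_mem
    (Filter.Eventually.of_forall fun x => (integrable_fourierKernel_mul c hf x).1)
    (integrable_fourierKernel_mul c hf x) ?_ ?_ (hf.norm.const_mul _) ?_).2
  · refine h.congr_deriv ?_
    rw [integral_const_mul]
    rfl
  · exact ((Continuous.aestronglyMeasurable (by fun_prop)).mul
      ((Complex.continuous_ofReal.aestronglyMeasurable).mul hf.1)).const_mul _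
  · filter_upwards [hν] with y hy z _
    rw [norm_mul, norm_mul, norm_mul, norm_mul, norm_fourierKernel, Complex.norm_I, one_mul,
      one_mul, Complex.norm_real, Complex.norm_real, Real.norm_eq_abs, Real.norm_eq_abs]
    have := abs_le.2 hy
    have h0 := norm_nonneg (f y)
    gcongr
    nlinarith
  · refine Filter.Eventually.of_forall fun y z _ => ?_
    have h1 := ((((hasDerivAt_id (z : ℂ)).const_mul (Complex.I * c)).mul_const
      (y : ℂ)).cexp.mul_const (f y)).comp_ofReal
    refine h1.congr_deriv ?_
    simp only [id]
    ring

variable [IsFiniteMeasure ν]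

/-- The operator `f ↦ (x ↦ ∫ e^{icxy} f(y) dν(y))` on `L²(ν)`, as a bounded operator. -/
noncomputable def fourierOperator (c : ℝ) (ν : Measure ℝ) [IsFiniteMeasure ν] :
    Lp ℂ 2 ν →L[ℂ] Lp ℂ 2 ν :=
  (fourierLinearMap c ν).mkContinuousOfExistsBound (exists_bound_fourierLinearMap c ν)

theorem coeFn_fourierOperator (c : ℝ) (f : Lp ℂ 2 ν) :
    (fourierOperator c ν f : ℝ → ℂ) =ᵐ[ν] fourierIntegralFun c ν f :=
  (memLp_fourierIntegralFun c (integrable_of_L2 f)).coeFn_toLp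

theorem conj_fourierKernel (c x y : ℝ) :
    (starRingEnd ℂ) (Complex.exp (Complex.I * c * x * y)) =
      Complex.exp (Complex.I * (-c : ℝ) * x * y) := by
  rw [← Complex.exp_conj]
  simp

theorem adjoint_fourierOperator (c : ℝ) :
    ContinuousLinearMap.adjoint (fourierOperator c ν) = fourierOperator (-c) ν := by
  symm
  rw [ContinuousLinearMap.eq_adjoint_iff]
  intro f g
  rw [L2.inner_def, L2.inner_def]
  have hint : Integrable (Function.uncurry fun x y : ℝ =>
      Complex.exp (Complex.I * c * x * y) * (g x * (starRingEnd ℂ) (f y))) (ν.prod ν) := by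
    refine ((integrable_of_L2 g).mul_prod
      (Complex.conjLIE.toContinuousLinearEquiv.toContinuousLinearMap.integrable_comp
        (integrable_of_L2 f))).bdd_mul (c := 1) (Continuous.aestronglyMeasurable (by fun_prop))
      (Filter.Eventually.of_forall fun z => ?_)
    rw [norm_fourierKernel]
  calc ∫ x, inner ℂ ((fourierOperator (-c) ν f : ℝ → ℂ) x) (g x) ∂ν
      = ∫ x, ∫ y, Complex.exp (Complex.I * c * x * y) * (g x * (starRingEnd ℂ) (f y)) ∂ν ∂ν := by
        refine integral_congr_ae ?_
        filter_upwards [coeFn_fourierOperator (-c) f] with x hx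
        rw [hx, RCLike.inner_apply, fourierIntegralFun, ← integral_conj, ← integral_const_mul]
        refine integral_congr_ae (Filter.Eventually.of_forall fun y => ?_)
        simp only [map_mul, conj_fourierKernel, neg_neg]
        ring
    _ = ∫ y, ∫ x, Complex.exp (Complex.I * c * x * y) * (g x * (starRingEnd ℂ) (f y)) ∂ν ∂ν :=
        integral_integral_swap hint
    _ = ∫ y, inner ℂ (f y) ((fourierOperator c ν g : ℝ → ℂ) y) ∂ν := by
        refine integral_congr_ae ?_
        filter_upwards [coeFn_fourierOperator c g] with y hy
        rw [hy, RCLike.inner_apply, fourierIntegralFun, ← integral_mul_const]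
        refine integral_congr_ae (Filter.Eventually.of_forall fun x => ?_)
        simp only [mul_right_comm _ (y : ℂ) (x : ℂ)]
        ring

/-- Changing the sign of the intermediate variable turns one composition of the transforms for `c`
and `-c` into the other. -/
theorem isStarNormal_fourierOperator (c : ℝ) (hneg : ν.IsNegInvariant) :
    IsStarNormal (fourierOperator c ν) := by
  constructor
  rw [ContinuousLinearMap.star_eq_adjoint, adjoint_fourierOperator]
  ext1 f
  rw [mul_apply_eq_comp, mul_apply_eq_comp]
  refine Lp.ext ?_
  filter_upwards [coeFn_fourierOperator (-c) (fourierOperator c ν f),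
    coeFn_fourierOperator c (fourierOperator (-c) ν f)] with x h1 h2
  rw [h1, h2]
  have h3 : fourierIntegralFun (-c) ν (fourierOperator c ν f) x =
      fourierIntegralFun (-c) ν (fourierIntegralFun c ν f) x :=
    integral_congr_ae ((coeFn_fourierOperator c f).mono fun y hy => by simp only [hy])
  have h4 : fourierIntegralFun c ν (fourierOperator (-c) ν f) x =
      fourierIntegralFun c ν (fourierIntegralFun (-c) ν f) x :=
    integral_congr_ae ((coeFn_fourierOperator (-c) f).mono fun y hy => by simp only [hy])
  rw [h3, h4]
  unfold fourierIntegralFun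
  rw [← integral_neg_eq_self _ ν]
  refine integral_congr_ae (Filter.Eventually.of_forall fun y => ?_)
  simp

/-- On functions orthogonal to the polynomials of degree less than `n`, the Fourier integral is
pointwise controlled by the error of Chebyshev interpolation. -/
theorem norm_fourierIntegralFun_le_of_orthogonal (hν : ∀ᵐ y ∂ν, y ∈ Set.Icc (-1 : ℝ) 1) (c : ℝ)
    {n : ℕ} (hn : n ≠ 0) {f : Lp ℂ 2 ν} (hf : f ∈ ((degreeLT ℂ n).map (polynomialLp ν hν))ᗮ)
    (x : ℝ) : ‖fourierIntegralFun c ν f x‖ ≤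
      2 * (|c * x| / 2) ^ n / n.factorial * ∫ y, ‖f y‖ ∂ν := by
  obtain ⟨p, hp, hb⟩ := exists_polynomial_norm_cexp_sub_le (c * x) hn
  have hp0 : ∫ y : ℝ, p.eval (y : ℂ) * f y ∂ν = 0 := by
    rw [← inner_polynomialLp hν]
    refine (Submodule.mem_orthogonal _ _).1 hf _ (Submodule.mem_map_of_mem ?_)
    rw [mem_degreeLT]
    exact (degree_map_le).trans_lt hp
  have hfi := integrable_of_L2 f
  have h1 : fourierIntegralFun c ν f x =
      ∫ y : ℝ, (Complex.exp (Complex.I * c * x * y) * f y - p.eval (y : ℂ) * f y) ∂ν := by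
    rw [integral_sub (integrable_fourierKernel_mul c hfi x) (integrable_polynomial_mul hν p hfi),
      hp0, sub_zero]
    rfl
  rw [h1, ← integral_const_mul]
  refine norm_integral_le_of_norm_le (hfi.norm.const_mul _) (hν.mono fun y hy => ?_)
  rw [← sub_mul, norm_mul]
  have h2 := hb y hy
  rw [Complex.ofReal_mul, ← mul_assoc] at h2
  gcongr

theorem norm_fourierOperator_le_of_orthogonal (hν : ∀ᵐ y ∂ν, y ∈ Set.Icc (-1 : ℝ) 1) (c : ℝ)
    {n : ℕ} (hn : n ≠ 0) {f : Lp ℂ 2 ν} (hf : f ∈ ((degreeLT ℂ n).map (polynomialLp ν hν))ᗮ) :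
    ‖fourierOperator c ν f‖ ≤
      2 * (|c| / 2) ^ n / n.factorial * √(∫ x, x ^ (2 * n) ∂ν) * √(ν.real Set.univ) * ‖f‖ := by
  set A : ℝ := 2 * (|c| / 2) ^ n / n.factorial with hA
  set B : ℝ := √(ν.real Set.univ) * ‖f‖ with hB
  have hA0 : 0 ≤ A := by positivity
  have hB0 : 0 ≤ B := by positivity
  have hint : Integrable (fun x : ℝ => x ^ (2 * n)) ν := by
    refine Integrable.of_bound (C := 1) (by fun_prop) (hν.mono fun y hy => ?_)
    rw [norm_pow, Real.norm_eq_abs]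
    exact pow_le_one₀ (abs_nonneg _) (abs_le.2 hy)
  have hpt : ∀ᵐ x ∂ν, ‖(fourierOperator c ν f : ℝ → ℂ) x‖ ^ 2 ≤ (A * B) ^ 2 * x ^ (2 * n) := by
    filter_upwards [coeFn_fourierOperator c f] with x hx
    rw [hx]
    have h1 := norm_fourierIntegralFun_le_of_orthogonal hν c hn hf x
    -- Keeping `|x|^n` instead of bounding it by 1 is the source of the extra power of `n` depending
    -- on `α`.
    have h2 : ‖fourierIntegralFun c ν f x‖ ≤ A * B * |x| ^ n := by
      refine h1.trans ?_
      rw [abs_mul, mul_div_right_comm |c|, mul_pow]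
      calc 2 * ((|c| / 2) ^ n * |x| ^ n) / n.factorial * ∫ y, ‖f y‖ ∂ν
          = A * |x| ^ n * ∫ y, ‖f y‖ ∂ν := by rw [hA]; ring
        _ ≤ A * |x| ^ n * B := by gcongr; exact integral_norm_le_sqrt_mul_norm f
        _ = A * B * |x| ^ n := by ring
    calc ‖fourierIntegralFun c ν f x‖ ^ 2 ≤ (A * B * |x| ^ n) ^ 2 := by gcongr
      _ = (A * B) ^ 2 * x ^ (2 * n) := by
        rw [mul_pow, ← pow_mul, mul_comm n 2, (even_two_mul n).pow_abs]
  have hsq : ‖fourierOperator c ν f‖ ^ 2 ≤ (A * √(∫ x, x ^ (2 * n) ∂ν) * B) ^ 2 := by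
    rw [L2_norm_sq_eq_integral, mul_pow, mul_pow, Real.sq_sqrt (integral_nonneg fun x =>
      (even_two_mul n).pow_nonneg x), mul_right_comm, ← mul_pow, ← integral_const_mul]
    exact integral_mono_of_nonneg (Filter.Eventually.of_forall fun x => by positivity)
      (hint.const_mul _) hpt
  rw [mul_assoc (A * _)]
  exact le_of_sq_le_sq hsq (by positivity)

theorem finrank_map_degreeLT_le {E : Type*} [AddCommGroup E] [Module ℂ E] (L : ℂ[X] →ₗ[ℂ] E)
    (n : ℕ) : FiniteDimensional ℂ ((degreeLT ℂ n).map L) ∧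
      Module.finrank ℂ ((degreeLT ℂ n).map L) ≤ n := by
  have h := (degreeLTEquiv ℂ n).finrank_eq
  have : FiniteDimensional ℂ (degreeLT ℂ n) := (degreeLTEquiv ℂ n).symm.finiteDimensional
  exact ⟨inferInstance, (Submodule.finrank_map_le L _).trans (by rw [h]; simp)⟩

theorem isCompactOperator_fourierOperator (hν : ∀ᵐ y ∂ν, y ∈ Set.Icc (-1 : ℝ) 1) (c : ℝ) :
    IsCompactOperator (fourierOperator c ν) := by
  refine isCompactOperator_of_norm_le_on_orthogonal fun ε hε => ?_
  have hM : ∀ n : ℕ, √(∫ x, x ^ (2 * n) ∂ν) * √(ν.real Set.univ) ≤ ν.real Set.univ := fun n => by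
    have h1 : ∫ x, x ^ (2 * n) ∂ν ≤ ν.real Set.univ := by
      have h2 := norm_integral_le_of_norm_le_const (μ := ν) (C := 1)
        (f := fun x : ℝ => x ^ (2 * n)) (hν.mono fun y hy => by
        rw [norm_pow, Real.norm_eq_abs]
        exact pow_le_one₀ (abs_nonneg _) (abs_le.2 hy))
      rw [one_mul] at h2
      exact (le_abs_self _).trans h2
    calc _ ≤ √(ν.real Set.univ) * √(ν.real Set.univ) := by gcongr
      _ = ν.real Set.univ := Real.mul_self_sqrt measureReal_nonneg
  have ht := (FloorSemiring.tendsto_pow_div_factorial_atTop (|c| / 2)).mul_const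
    (2 * ν.real Set.univ)
  rw [zero_mul] at ht
  obtain ⟨n, hn, hlt⟩ := ((Filter.eventually_ge_atTop 1).and
    (ht.eventually (gt_mem_nhds hε))).exists
  refine ⟨(degreeLT ℂ n).map (polynomialLp ν hν), (finrank_map_degreeLT_le _ n).1, fun f hf => ?_⟩
  refine (norm_fourierOperator_le_of_orthogonal hν c (by omega) hf).trans ?_
  gcongr
  rw [mul_assoc]
  calc 2 * (|c| / 2) ^ n / n.factorial * (√(∫ x, x ^ (2 * n) ∂ν) * √(ν.real Set.univ))
      ≤ 2 * (|c| / 2) ^ n / n.factorial * ν.real Set.univ := by gcongr; exact hM n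
    _ = (|c| / 2) ^ n / n.factorial * (2 * ν.real Set.univ) := by ring
    _ ≤ ε := hlt.le

/-- The transform of `f` is continuous, so it vanishes throughout `(-1, 1)`. Each differentiation
multiplies the integrand by `icy`, so evaluation at 0 kills all moments of `f`. -/
theorem fourierOperator_injective (hν : ∀ᵐ y ∂ν, y ∈ Set.Icc (-1 : ℝ) 1)
    (hac : volume.restrict (Set.Ioo (-1 : ℝ) 1) ≪ ν) {c : ℝ} (hc : c ≠ 0) (f : Lp ℂ 2 ν)
    (hf : fourierOperator c ν f = 0) : f = 0 := by
  have hfi := integrable_of_L2 f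
  have h0 : Set.EqOn (fourierIntegralFun c ν f) (fun _ => 0) (Set.Ioo (-1) 1) := by
    refine Measure.eqOn_open_of_ae_eq (hac.ae_eq ?_) isOpen_Ioo
      (continuous_fourierIntegralFun c hfi).continuousOn continuousOn_const
    filter_upwards [coeFn_fourierOperator c f, Lp.coeFn_zero ℂ 2 ν] with x h1 h2
    rw [← h1, hf, h2]
    rfl
  have hki : ∀ k : ℕ, Integrable (fun y : ℝ => (y : ℂ) ^ k * f y) ν := fun k => by
    simpa using integrable_polynomial_mul hν (X ^ k) hfi
  have hk : ∀ k : ℕ, ∀ x ∈ Set.Ioo (-1 : ℝ) 1,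
      fourierIntegralFun c ν (fun y : ℝ => (y : ℂ) ^ k * f y) x = 0 := by
    intro k
    induction k with
    | zero => simpa using fun x h1 h2 => h0 ⟨h1, h2⟩
    | succ k ih =>
      intro x hx
      have h1 := hasDerivAt_fourierIntegralFun hν c (hki k) x
      have h2 : HasDerivAt (fourierIntegralFun c ν (fun y : ℝ => (y : ℂ) ^ k * f y)) 0 x :=
        (hasDerivAt_const x (0 : ℂ)).congr_of_eventuallyEq
          (Filter.eventually_of_mem (isOpen_Ioo.mem_nhds hx) ih)
      have h3 := (mul_eq_zero.1 (h1.unique h2)).resolve_left (by simp [hc])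
      simpa [pow_succ', mul_assoc] using h3
  have hmom : ∀ k : ℕ, ∫ y : ℝ, (y : ℂ) ^ k * f y ∂ν = 0 := fun k => by
    simpa [fourierIntegralFun] using hk k 0 (by norm_num)
  have hpoly : ∀ p : ℂ[X], ∫ y : ℝ, p.eval (y : ℂ) * f y ∂ν = 0 := fun p => by
    simp_rw [eval_eq_sum_range, Finset.sum_mul, mul_assoc]
    rw [integral_finsetSum _ fun k _ => (hki k).const_mul _]
    simp [integral_const_mul, hmom]
  refine Lp.ext (Filter.EventuallyEq.trans (g := fun _ => (0 : ℂ)) ?_ (Lp.coeFn_zero ℂ 2 ν).symm)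
  exact ae_eq_zero_of_integral_polynomial_mul_eq_zero hν hfi hpoly

end FourierOperator

/-! ### The weighted measure -/

section JacobiMeasure

theorem ae_mem_Icc_jacobiMeasure (α : ℝ) : ∀ᵐ y ∂(jacobiMeasure α), y ∈ Set.Icc (-1 : ℝ) 1 :=
  (withDensity_absolutelyContinuous _ _).ae_le (ae_restrict_mem measurableSet_Icc)

theorem measurable_jacobiDensity (α : ℝ) :
    Measurable fun x : ℝ => ENNReal.ofReal ((1 - x ^ 2) ^ α) := by
  fun_prop

theorem restrict_Ioo_absolutelyContinuous_jacobiMeasure (α : ℝ) :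
    volume.restrict (Set.Ioo (-1 : ℝ) 1) ≪ jacobiMeasure α := by
  have h : volume.restrict (Set.Ioo (-1 : ℝ) 1) = volume.restrict (Set.Icc (-1 : ℝ) 1) :=
    Measure.restrict_congr_set Ioo_ae_eq_Icc
  rw [jacobiMeasure, h]
  refine withDensity_absolutelyContinuous' (measurable_jacobiDensity α).aemeasurable ?_
  rw [← h]
  filter_upwards [ae_restrict_mem measurableSet_Ioo] with x hx
  have : 0 < 1 - x ^ 2 := by nlinarith [hx.1, hx.2]
  exact (ENNReal.ofReal_pos.2 (Real.rpow_pos_of_pos this α)).ne'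

theorem isNegInvariant_jacobiMeasure (α : ℝ) : (jacobiMeasure α).IsNegInvariant := by
  constructor
  ext s hs
  rw [Measure.neg, Measure.map_apply measurable_neg hs, jacobiMeasure,
    withDensity_apply _ (measurable_neg hs), withDensity_apply _ hs,
    Measure.restrict_restrict (measurable_neg hs), Measure.restrict_restrict hs,
    ← lintegral_indicator ((measurable_neg hs).inter measurableSet_Icc),
    ← lintegral_indicator (hs.inter measurableSet_Icc),
    ← lintegral_neg_eq_self]
  refine lintegral_congr fun x => ?_
  simp only [Set.indicator, Set.mem_inter_iff, Set.mem_preimage, Set.mem_Icc, neg_neg, neg_sq]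
  congr 1
  rw [eq_iff_iff]
  constructor <;> rintro ⟨h1, h2, h3⟩ <;> exact ⟨by simpa using h1, by linarith, by linarith⟩

theorem integral_jacobiMeasure (α : ℝ) (g : ℝ → ℝ) :
    ∫ x, g x ∂(jacobiMeasure α) = ∫ x in (-1 : ℝ)..1, g x * (1 - x ^ 2) ^ α := by
  rw [jacobiMeasure, integral_withDensity_eq_integral_toReal_smul (measurable_jacobiDensity α)
    (Filter.Eventually.of_forall fun _ => ENNReal.ofReal_lt_top),
    intervalIntegral.integral_of_le (by norm_num), ← integral_Icc_eq_integral_Ioc]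
  refine setIntegral_congr_fun measurableSet_Icc fun x hx => ?_
  have : 0 ≤ 1 - x ^ 2 := by nlinarith [hx.1, hx.2]
  simp only [smul_eq_mul]
  rw [ENNReal.toReal_ofReal (Real.rpow_nonneg this α), mul_comm]

theorem jacobiMeasure_real_univ_le {α : ℝ} (hα : 0 ≤ α) :
    (jacobiMeasure α).real Set.univ ≤ 2 := by
  have h := integral_jacobiMeasure α (fun _ => 1)
  rw [integral_const, smul_eq_mul, mul_one] at h
  rw [h]
  have h2 : ∫ _x in (-1 : ℝ)..1, (1 : ℝ) = 2 := by norm_num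
  rw [← h2]
  refine intervalIntegral.integral_mono_on (by norm_num) ?_ intervalIntegrable_const fun x hx => ?_
  · refine Continuous.intervalIntegrable (continuous_const.mul ?_) _ _
    exact (continuous_const.sub (continuous_pow 2)).rpow_const fun _ => Or.inr hα
  · rw [one_mul]
    exact Real.rpow_le_one (by nlinarith [hx.1, hx.2]) (by nlinarith) hα

end JacobiMeasure

/-! ### From the factorial bound to the stated bound -/

section Estimate

theorem chebyshev_error_le {c α : ℝ} (hc : 0 < c) (hα : 0 ≤ α) {n : ℕ}
    (hn : Real.exp 1 * c < 2 * (n : ℝ) - 1) :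
    2 * (c / 2) ^ n / n.factorial * √(Real.Gamma (α + 1) / (n : ℝ) ^ (α + 1)) * √2 ≤
      ((2 / Real.exp 1) ^ (1 + α / 2) * Real.pi * Real.Gamma (α + 1) ^ (1 / 2 : ℝ)) /
        (c ^ (α / 2 + 1) * Real.log ((2 * (n : ℝ) - 1) / (Real.exp 1 * c))) *
        (Real.exp 1 * c / (2 * (n : ℝ) - 1)) ^ ((n : ℝ) + α / 2) := by
  set e := Real.exp 1 with he
  have he0 : 0 < e := Real.exp_pos 1
  have hec : 0 < e * c := by positivity
  set N : ℝ := 2 * (n : ℝ) - 1 with hN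
  have hN0 : 0 < N := hec.trans hn
  have hn0 : (0 : ℝ) < n := by linarith
  have hG : 0 < Real.Gamma (α + 1) := Real.Gamma_pos_of_pos (by linarith)
  set g := Real.Gamma (α + 1) with hg
  set q : ℝ := e * c / N with hq
  have hq0 : 0 < q := by positivity
  have hr : 1 < N / (e * c) := (one_lt_div hec).2 hn
  have hlog0 : 0 < Real.log (N / (e * c)) := Real.log_pos hr
  have hlogq : Real.log (N / (e * c)) * q ≤ 1 := by
    have h1 : Real.log (N / (e * c)) ≤ N / (e * c) :=
      (Real.log_le_sub_one_of_pos (by positivity)).trans (by linarith)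
    calc Real.log (N / (e * c)) * q ≤ N / (e * c) * q := by gcongr
      _ = 1 := by rw [hq]; field_simp
  -- Regrouping powers leaves one spare factor `q`, which `q ≤ 1 / log(1/q)` trades for the
  -- logarithm.
  have hrhs : Real.pi * √g * (2 / N) ^ (1 + α / 2) * q ^ n ≤
      ((2 / e) ^ (1 + α / 2) * Real.pi * g ^ (1 / 2 : ℝ)) /
        (c ^ (α / 2 + 1) * Real.log (N / (e * c))) * q ^ ((n : ℝ) + α / 2) := by
    have h1 : (2 / N) ^ (1 + α / 2) = (2 / e) ^ (1 + α / 2) / c ^ (α / 2 + 1) * q ^ (1 + α / 2) := by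
      rw [add_comm (α / 2) 1, ← Real.div_rpow (by positivity) hc.le,
        ← Real.mul_rpow (by positivity) hq0.le]
      congr 1
      rw [hq]
      field_simp
    have h2 : q ^ (1 + α / 2) * q ^ n = q * q ^ ((n : ℝ) + α / 2) := by
      rw [← Real.rpow_natCast, ← Real.rpow_add hq0, ← Real.rpow_one_add' hq0.le (by positivity)]
      congr 1
      ring
    have h3 : q ≤ 1 / Real.log (N / (e * c)) := by
      rw [le_div_iff₀ hlog0, mul_comm]
      exact hlogq
    calc Real.pi * √g * (2 / N) ^ (1 + α / 2) * q ^ n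
        = ((2 / e) ^ (1 + α / 2) * Real.pi * √g) / c ^ (α / 2 + 1) *
            q ^ ((n : ℝ) + α / 2) * q := by
          rw [h1, mul_assoc _ (_ * _), mul_assoc _ (q ^ (1 + α / 2)), h2]
          ring
      _ ≤ ((2 / e) ^ (1 + α / 2) * Real.pi * √g) / c ^ (α / 2 + 1) *
            q ^ ((n : ℝ) + α / 2) * (1 / Real.log (N / (e * c))) := by gcongr
      _ = _ := by
          rw [Real.sqrt_eq_rpow]
          field_simp
  refine le_trans ?_ hrhs
  have hfac := Stirling.le_factorial_stirling n
  rw [← he] at hfac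
  have hpow : (c / 2) ^ n ≤ q ^ n * (n / e) ^ n := by
    rw [← mul_pow]
    gcongr
    rw [hq, div_mul_div_comm, div_le_div_iff₀ two_pos (by positivity)]
    nlinarith [mul_pos hec hn0]
  -- A factor `√n` is split off for the `√(2πn)` in Stirling's bound to absorb.
  have hsq : √(g / (n : ℝ) ^ (α + 1)) = √g * √n / (n : ℝ) ^ (1 + α / 2) := by
    rw [Real.sqrt_div hG.le, div_eq_div_iff (by positivity) (by positivity), mul_assoc]
    congr 1
    rw [Real.sqrt_eq_rpow, Real.sqrt_eq_rpow, ← Real.rpow_mul hn0.le, ← Real.rpow_add hn0]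
    congr 1
    ring
  have hNs : 1 / (n : ℝ) ^ (1 + α / 2) ≤ (2 / N) ^ (1 + α / 2) := by
    rw [one_div, ← Real.inv_rpow hn0.le]
    refine Real.rpow_le_rpow (by positivity) ?_ (by positivity)
    rw [inv_eq_one_div, div_le_div_iff₀ hn0 hN0]
    linarith
  have hs2 : √(2 * Real.pi * n) = √2 * √Real.pi * √n := by
    rw [Real.sqrt_mul (by positivity), Real.sqrt_mul (by norm_num)]
  have hpi : 1 ≤ √Real.pi := Real.one_le_sqrt.2 (by linarith [Real.pi_gt_three])
  have hmain : (c / 2) ^ n / n.factorial * (√2 * √n) ≤ q ^ n := by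
    rw [div_mul_eq_mul_div, div_le_iff₀ (by positivity)]
    calc (c / 2) ^ n * (√2 * √n) ≤ q ^ n * (n / e) ^ n * (√2 * √Real.pi * √n) := by
          gcongr
          exact le_mul_of_one_le_right (by positivity) hpi
      _ = q ^ n * (√(2 * Real.pi * n) * (n / e) ^ n) := by rw [hs2]; ring
      _ ≤ q ^ n * n.factorial := by gcongr
  rw [hsq]
  calc 2 * (c / 2) ^ n / n.factorial * (√g * √n / (n : ℝ) ^ (1 + α / 2)) * √2
      = 2 * √g * (1 / (n : ℝ) ^ (1 + α / 2)) * ((c / 2) ^ n / n.factorial * (√2 * √n)) := by ring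
    _ ≤ Real.pi * √g * (2 / N) ^ (1 + α / 2) * q ^ n := by
      gcongr
      linarith [Real.pi_gt_three]

theorem mul_sq_decay_bound {c α L x : ℝ} (hc : 0 < c) {q g d : ℝ} (hq : 0 < q) (hg : 0 < g)
    (hd : 0 < d) :
    c / (2 * Real.pi) * ((d ^ (1 + α / 2) * Real.pi * g ^ (1 / 2 : ℝ)) /
        (c ^ (α / 2 + 1) * L) * q ^ (x + α / 2)) ^ 2 =
      (Real.pi / 2 * d ^ (α + 2) * g) / (c ^ (α + 1) * L ^ 2) * q ^ (2 * x + α) := by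
  have h1 : d ^ (α + 2) = (d ^ (1 + α / 2)) ^ 2 := by
    rw [← Real.rpow_natCast, ← Real.rpow_mul hd.le]; congr 1; push_cast; ring
  have h2 : q ^ (2 * x + α) = (q ^ (x + α / 2)) ^ 2 := by
    rw [← Real.rpow_natCast, ← Real.rpow_mul hq.le]; congr 1; push_cast; ring
  have h3 : (c ^ (α / 2 + 1)) ^ 2 = c ^ (α + 1) * c := by
    rw [← Real.rpow_natCast, ← Real.rpow_mul hc.le, ← Real.rpow_add_one hc.ne']
    congr 1; push_cast; ring
  have h4 : (g ^ (1 / 2 : ℝ)) ^ 2 = g := by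
    rw [← Real.sqrt_eq_rpow, Real.sq_sqrt hg.le]
  rw [h1, h2, mul_pow, div_pow, mul_pow, mul_pow, h4, mul_pow, h3]
  have hc' : c ^ (α + 1) ≠ 0 := (Real.rpow_pos_of_pos hc _).ne'
  -- For `L = 0` both sides are zero, as division by zero gives zero.
  by_cases hL : L = 0
  · simp [hL]
  field_simp

end Estimate

/-! ### Assembly for the weighted transform -/

theorem isStarNormal_weightedFourier (c α : ℝ) (hα : 0 ≤ α) :
    IsStarNormal (weightedFourier c α hα) :=
  haveI := isFiniteMeasure_jacobiMeasure hα
  isStarNormal_fourierOperator c (isNegInvariant_jacobiMeasure α)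

theorem exists_isEigenvalueSequence_weightedFourier {c α : ℝ} (hc : c ≠ 0) (hα : 0 ≤ α) :
    ∃ μ : ℕ → ℂ, IsEigenvalueSequence (weightedFourier c α hα) μ :=
  haveI := isFiniteMeasure_jacobiMeasure hα
  exists_isEigenvalueSequence
    (isCompactOperator_fourierOperator (ae_mem_Icc_jacobiMeasure α) c)
    (isStarNormal_weightedFourier c α hα)
    (fourierOperator_injective (ae_mem_Icc_jacobiMeasure α)
      (restrict_Ioo_absolutelyContinuous_jacobiMeasure α) hc)
    (not_finiteDimensional_L2 (ae_mem_Icc_jacobiMeasure α)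
      (restrict_Ioo_absolutelyContinuous_jacobiMeasure α))

theorem norm_eigenvalue_weightedFourier_le {c α : ℝ} (hc : 0 < c) (hα : 0 ≤ α) {μ : ℕ → ℂ}
    (hμ : IsEigenvalueSequence (weightedFourier c α hα) μ) {n : ℕ} (hn : n ≠ 0) :
    ‖μ n‖ ≤ 2 * (c / 2) ^ n / n.factorial *
      √(Real.Gamma (α + 1) / (n : ℝ) ^ (α + 1)) * √2 := by
  have := isFiniteMeasure_jacobiMeasure hα
  have hν := ae_mem_Icc_jacobiMeasure α
  obtain ⟨hV, hVn⟩ := finrank_map_degreeLT_le (polynomialLp (jacobiMeasure α) hν) n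
  refine hμ.norm_le hVn fun f hf => ?_
  refine (norm_fourierOperator_le_of_orthogonal hν c hn hf).trans ?_
  rw [abs_of_pos hc, integral_jacobiMeasure]
  gcongr
  · exact integral_pow_mul_one_sub_sq_rpow_le hα hn
  · exact jacobiMeasure_real_univ_le hα

theorem theorem3p1 (c α : ℝ) (hc : 0 < c) (hα : 0 ≤ α) :
    (∃ μ : ℕ → ℂ, IsEigenvalueSequence (weightedFourier c α hα) μ) ∧
    ∀ μ : ℕ → ℂ, IsEigenvalueSequence (weightedFourier c α hα) μ →
      IsEigenvalueSequence (weightedSinc c α hα)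
        (fun n => ((c / (2 * Real.pi) * ‖μ n‖ ^ 2 : ℝ) : ℂ)) ∧
      ∀ n : ℕ, (Real.exp 1 * c + 1) / 2 < (n : ℝ) →
        ‖μ n‖ ≤
          ((2 / Real.exp 1) ^ (1 + α / 2) * Real.pi * Real.Gamma (α + 1) ^ (1 / 2 : ℝ)) /
            (c ^ (α / 2 + 1) * Real.log ((2 * (n : ℝ) - 1) / (Real.exp 1 * c))) *
            (Real.exp 1 * c / (2 * (n : ℝ) - 1)) ^ ((n : ℝ) + α / 2) ∧
        c / (2 * Real.pi) * ‖μ n‖ ^ 2 ≤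
          (Real.pi / 2 * (2 / Real.exp 1) ^ (α + 2) * Real.Gamma (α + 1)) /
            (c ^ (α + 1) * Real.log ((2 * (n : ℝ) - 1) / (Real.exp 1 * c)) ^ 2) *
            (Real.exp 1 * c / (2 * (n : ℝ) - 1)) ^ (2 * (n : ℝ) + α) := by
  refine ⟨exists_isEigenvalueSequence_weightedFourier hc.ne' hα, fun μ hμ => ⟨?_, fun n hn => ?_⟩⟩
  · exact hμ.smul_adjoint_comp (isStarNormal_weightedFourier c α hα) (by positivity)
  · have hec : 0 < Real.exp 1 * c := mul_pos (Real.exp_pos 1) hc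
    have hn' : Real.exp 1 * c < 2 * (n : ℝ) - 1 := by linarith
    have hn0 : n ≠ 0 := by
      rintro rfl
      rw [Nat.cast_zero] at hn'
      linarith
    have h := (norm_eigenvalue_weightedFourier_le hc hα hμ hn0).trans
      (chebyshev_error_le hc hα hn')
    refine ⟨h, ?_⟩
    rw [← mul_sq_decay_bound hc (div_pos hec (hec.trans hn'))
      (Real.Gamma_pos_of_pos (by linarith)) (div_pos two_pos (Real.exp_pos 1))]
    gcongr
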